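/- For $j=1,2,3$ let $S_j(x)=\frac15x+\frac25(j-1)$ on $\mathbb R$, and let $P$ be the standard triadic Cantor distribution, i.e. the unique Borel probability measure on $\mathbb R$ with $P=\frac13\sum_{j=1}^3P\circ S_j^{-1}$. For $n\ge 1$ let $$V_n=\inf\Big\{\int\min_{a\in\alpha}(x-a)^2\,dP(x)\;:\;\alpha\subset\mathbb R,\ 1\le\operatorname{card}(\alpha)\le n\Big\}$$ be the $n$th quantization error of $P$, let $V$ be the variance of $P$, let $\beta=\log 3/\log 5$, and let $$f(x)=x^{2/\beta}\big((2V-V_2)-x(V-V_2)\big).$$ **Theorem.** (i) For all integers $\ell\ge 0$ and $n$ with $3^\ell\le n\le 2\cdot 3^\ell$ we have $n^{2/\beta}V_n=f(n/3^\ell)$. (ii) The function $f$ attains a maximum $M$ on $[1,2]$, and $f(1)<M$. Let $(n_k)_{k\ge1}$ be the increasing enumeration of all positive integers $n$ with $3^\ell\le n\le2\cdot3^\ell$ for some integer $\ell\ge0$. The set of accumulation points (limits of convergent subsequences) of the sequence $\big(n_k^{2/\beta}V_{n_k}\big)_{k\ge1}$ is exactly the interval $[f(1),M]$, which thus has more than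 one point. (iii) Consequently the $\beta$-dimensional quantization coefficient $\lim_{n\to\infty}n^{2/\beta}V_n$ of $P$ does not exist. -/

import Mathlib

open MeasureTheory

noncomputable section

namespace TriadicCantor

/-- The contractive similarities `x ↦ x / 5 + 2 j / 5`, `j = 0, 1, 2`. -/
def S (j : Fin 3) (x : ℝ) : ℝ := x / 5 + 2 / 5 * ((j : ℕ) : ℝ)

/-- The self-similarity equation `P = ∑ⱼ (1/3) P ∘ Sⱼ⁻¹`, for Borel probability measures on `ℝ`. -/
def IsSelfSimilar (P : Measure ℝ) : Prop :=
  IsProbabilityMeasure P ∧ P = ∑ j : Fin 3, (3 : ENNReal)⁻¹ • P.map (S j)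

/-! ### Existence and uniqueness of the self-similar probability measure -/

theorem measurable_S (j : Fin 3) : Measurable (S j) := by
  unfold S; fun_prop

/-- The uniform distribution on three digits. -/
def digit : Measure (Fin 3) := ∑ j : Fin 3, (3 : ENNReal)⁻¹ • Measure.dirac j

instance : IsProbabilityMeasure digit := by
  constructor
  simp only [digit, Measure.coe_finsetSum, Finset.sum_apply, Measure.smul_apply, smul_eq_mul,
    measure_univ, mul_one, Finset.sum_const, Finset.card_univ, Fintype.card_fin, nsmul_eq_mul]
  exact ENNReal.mul_inv_cancel (by simp) (by simp)

/-- Put the digit `j` in front of the digit sequence `w`. -/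
def prep (j : Fin 3) (w : ℕ → Fin 3) : ℕ → Fin 3
  | 0 => j
  | n + 1 => w n

theorem measurable_prep (j : Fin 3) : Measurable (prep j) := by
  refine measurable_pi_lambda _ fun n => ?_
  cases n with
  | zero => exact measurable_const
  | succ n => exact measurable_pi_apply n

theorem infinitePi_digit_eq :
    Measure.infinitePi (fun _ : ℕ => digit)
      = ∑ j : Fin 3, (3 : ENNReal)⁻¹ • (Measure.infinitePi (fun _ : ℕ => digit)).map (prep j) := by
  classical
  symm
  refine Measure.eq_infinitePi _ fun s t ht => ?_
  have hm : MeasurableSet (Set.pi (s : Set ℕ) t) :=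
    MeasurableSet.pi s.countable_toSet fun i _ => ht i
  set s' : Finset ℕ := s.preimage Nat.succ (Nat.succ_injective.injOn) with hs'
  have key : ∀ j : Fin 3, (Measure.infinitePi (fun _ : ℕ => digit)) (prep j ⁻¹' Set.pi (s : Set ℕ) t)
      = (if 0 ∈ s then (t 0).indicator 1 j else 1) * ∏ i ∈ s', digit (t (i + 1)) := by
    intro j
    rw [← Measure.infinitePi_pi (μ := fun _ : ℕ => digit) (s := s') (t := fun i => t (i + 1))
      (fun i _ => ht (i + 1))]
    by_cases hj : 0 ∈ s → j ∈ t 0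
    · have h1 : prep j ⁻¹' Set.pi (s : Set ℕ) t = Set.pi (s' : Set ℕ) (fun i => t (i + 1)) := by
        ext w
        simp only [Set.mem_preimage, Set.mem_pi, Finset.mem_coe, hs', Finset.mem_preimage]
        constructor
        · intro h i hi
          exact h (i + 1) hi
        · intro h i hi
          cases i with
          | zero => exact hj hi
          | succ i => exact h i hi
      rw [h1]
      split_ifs with h0
      · simp [hj h0]
      · simp
    · have hj' : 0 ∈ s ∧ j ∉ t 0 := by simpa using hj
      have h1 : prep j ⁻¹' Set.pi (s : Set ℕ) t = ∅ := by
        ext w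
        simp only [Set.mem_preimage, Set.mem_pi, Finset.mem_coe, Set.mem_empty_iff_false, iff_false]
        intro h
        exact hj'.2 (h 0 hj'.1)
      rw [h1]
      simp [hj'.1, hj'.2]
  simp only [Measure.coe_finsetSum, Finset.sum_apply, Measure.smul_apply, smul_eq_mul]
  simp_rw [Measure.map_apply (measurable_prep _) hm, key, ← mul_assoc]
  rw [← Finset.sum_mul]
  have hprod : ∏ i ∈ s, digit (t i)
      = (if 0 ∈ s then digit (t 0) else 1) * ∏ i ∈ s', digit (t (i + 1)) := by
    have h2 : ∏ i ∈ s', digit (t (i + 1)) = ∏ i ∈ s.erase 0, digit (t i) := by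
      refine Finset.prod_bij (fun i _ => i + 1) ?_ ?_ ?_ ?_
      · intro i hi
        simpa [hs'] using hi
      · intro a _ b _ h
        exact Nat.succ_injective h
      · intro b hb
        obtain ⟨hb0, hbs⟩ := Finset.mem_erase.1 hb
        obtain ⟨c, rfl⟩ := Nat.exists_eq_succ_of_ne_zero hb0
        exact ⟨c, by simpa [hs'] using hbs, rfl⟩
      · intro i _
        rfl
    rw [h2]
    split_ifs with h0
    · exact (Finset.mul_prod_erase s (fun i => digit (t i)) h0).symm
    · rw [Finset.erase_eq_of_notMem h0, one_mul]
  rw [hprod]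
  congr 1
  split_ifs with h0
  · simp [digit, Measure.dirac_apply' _ (ht 0)]
  · simp only [mul_one, Finset.sum_const, Finset.card_univ, Fintype.card_fin, nsmul_eq_mul]
    exact ENNReal.mul_inv_cancel (by simp) (by simp)

/-- The point of the Cantor set with base five digits `2 w 0, 2 w 1, …`. -/
def point (w : ℕ → Fin 3) : ℝ := ∑' n, 2 * ((w n : ℕ) : ℝ) * (1 / 5) ^ (n + 1)

theorem term_bound (w : ℕ → Fin 3) (n : ℕ) :
    ‖2 * ((w n : ℕ) : ℝ) * (1 / 5) ^ (n + 1)‖ ≤ 4 * (1 / 5 : ℝ) ^ n := by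
  have h : ((w n : ℕ) : ℝ) ≤ 2 := by exact_mod_cast Nat.le_of_lt_succ (w n).2
  have h5 : (0 : ℝ) < (1 / 5) ^ n := by positivity
  rw [Real.norm_of_nonneg (by positivity), pow_succ]
  nlinarith

theorem summable_bound : Summable fun n : ℕ => 4 * (1 / 5 : ℝ) ^ n :=
  (summable_geometric_of_lt_one (by norm_num) (by norm_num)).mul_left 4

theorem measurable_point : Measurable point := by
  have : Continuous point := by
    refine continuous_tsum (fun n => ?_) summable_bound fun n w => term_bound w n
    have : Continuous fun k : Fin 3 => ((k : ℕ) : ℝ) := continuous_of_discreteTopology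
    fun_prop
  exact this.measurable

theorem point_prep (j : Fin 3) (w : ℕ → Fin 3) : point (prep j w) = S j (point w) := by
  have hs : ∀ v : ℕ → Fin 3, Summable fun n => 2 * ((v n : ℕ) : ℝ) * (1 / 5) ^ (n + 1) :=
    fun v => Summable.of_norm_bounded summable_bound fun n => term_bound v n
  unfold point S
  rw [(hs (prep j w)).tsum_eq_zero_add, ← tsum_div_const, add_comm]
  congr 1
  · refine tsum_congr fun n => ?_
    simp only [prep]
    ring
  · simp only [prep]
    ring

theorem exists_selfSimilar : ∃ P : Measure ℝ, IsSelfSimilar P := by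
  refine ⟨(Measure.infinitePi (fun _ : ℕ => digit)).map point,
    Measure.isProbabilityMeasure_map measurable_point.aemeasurable, ?_⟩
  conv_lhs => rw [infinitePi_digit_eq]
  rw [← Measure.mapₗ_apply_of_measurable measurable_point, map_sum]
  refine Finset.sum_congr rfl fun j _ => ?_
  rw [map_smul, Measure.mapₗ_apply_of_measurable measurable_point,
    Measure.map_map measurable_point (measurable_prep j),
    Measure.map_map (measurable_S j) measurable_point]
  congr 2
  funext w
  exact point_prep j w

theorem charFun_selfSimilar {P : Measure ℝ} (hP : IsSelfSimilar P) (t : ℝ) :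
    charFun P t = (∑ j : Fin 3, (3 : ℂ)⁻¹ * Complex.exp (t * (2 / 5 * ((j : ℕ) : ℝ) : ℝ) * Complex.I))
      * charFun P (t / 5) := by
  have := hP.1
  have hint : ∀ j : Fin 3, Integrable (fun x : ℝ => Complex.exp (t * x * Complex.I))
      ((3 : ENNReal)⁻¹ • P.map (S j)) := by
    intro j
    have : IsProbabilityMeasure (P.map (S j)) :=
      Measure.isProbabilityMeasure_map (measurable_S j).aemeasurable
    refine Integrable.smul_measure ?_ (by simp)
    refine (integrable_const (1 : ℝ)).mono' (by fun_prop) (Filter.Eventually.of_forall fun x => ?_)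
    rw [← Complex.ofReal_mul, Complex.norm_exp_ofReal_mul_I]
  rw [charFun_apply_real]
  conv_lhs => rw [hP.2]
  rw [integral_finsetSum_measure fun j _ => hint j, Finset.sum_mul]
  refine Finset.sum_congr rfl fun j _ => ?_
  rw [integral_smul_measure, integral_map (measurable_S j).aemeasurable (by fun_prop),
    charFun_apply_real, mul_assoc, ← integral_const_mul]
  have : ((3 : ENNReal)⁻¹).toReal = (3 : ℝ)⁻¹ := by simp
  rw [this, Complex.real_smul]
  congr 1
  · simp
  · refine integral_congr_ae (Filter.Eventually.of_forall fun x => ?_)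
    simp only [S, ← Complex.exp_add]
    congr 1
    push_cast
    ring

theorem selfSimilar_unique {P Q : Measure ℝ} (hP : IsSelfSimilar P) (hQ : IsSelfSimilar Q) :
    P = Q := by
  have := hP.1
  have := hQ.1
  refine Measure.ext_of_charFun (funext fun t => ?_)
  have step : ∀ t : ℝ, ‖charFun P t - charFun Q t‖ ≤ ‖charFun P (t / 5) - charFun Q (t / 5)‖ := by
    intro t
    rw [charFun_selfSimilar hP t, charFun_selfSimilar hQ t, ← mul_sub, norm_mul]
    refine mul_le_of_le_one_left (norm_nonneg _) ((norm_sum_le _ _).trans ?_)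
    have : ∀ j : Fin 3,
        ‖(3 : ℂ)⁻¹ * Complex.exp (t * (2 / 5 * ((j : ℕ) : ℝ) : ℝ) * Complex.I)‖ = (3 : ℝ)⁻¹ := by
      intro j
      rw [norm_mul, ← Complex.ofReal_mul, Complex.norm_exp_ofReal_mul_I]
      simp
    simp only [this]
    norm_num
  have iter : ∀ n : ℕ, ‖charFun P t - charFun Q t‖
      ≤ ‖charFun P (t / 5 ^ n) - charFun Q (t / 5 ^ n)‖ := by
    intro n
    induction n with
    | zero => simp
    | succ n ih =>
      refine ih.trans ((step _).trans (le_of_eq ?_))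
      rw [div_div, ← pow_succ]
  have hlim : Filter.Tendsto (fun n : ℕ => t / (5 : ℝ) ^ n) Filter.atTop (nhds 0) :=
    tendsto_const_nhds.div_atTop (tendsto_pow_atTop_atTop_of_one_lt (by norm_num))
  have hcont : Continuous fun u : ℝ => ‖charFun P u - charFun Q u‖ := by
    have h1 : Continuous (charFun P) := continuous_charFun
    have h2 : Continuous (charFun Q) := continuous_charFun
    fun_prop
  have h0 := (hcont.tendsto 0).comp hlim
  simp only [charFun_zero, probReal_univ, Complex.ofReal_one, sub_self, norm_zero] at h0
  have := ge_of_tendsto h0 (Filter.Eventually.of_forall iter)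
  exact sub_eq_zero.1 (norm_le_zero_iff.1 this)

theorem existsUnique_selfSimilar : ∃! P : Measure ℝ, IsSelfSimilar P :=
  exists_selfSimilar.elim fun P hP => ⟨P, hP, fun _ hQ => selfSimilar_unique hQ hP⟩

/-- The standard triadic Cantor distribution: the unique Borel probability measure `P` on `ℝ`
with `P = ∑ⱼ (1/3) P ∘ Sⱼ⁻¹`. -/
def cantorDist : Measure ℝ := existsUnique_selfSimilar.choose

theorem cantorDist_selfSimilar : IsSelfSimilar cantorDist := existsUnique_selfSimilar.choose_spec.1

instance : IsProbabilityMeasure cantorDist := cantorDist_selfSimilar.1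

/-! ### Quantization -/

/-- The distortion error `V(P; α) = ∫ min_{a ∈ α} (x - a)² dP(x)` of a finite non-empty set `α`
(for a distribution `P` on `ℝ` with finite second moment). -/
def distortion (P : Measure ℝ) (α : Finset ℝ) (hα : α.Nonempty) : ℝ :=
  ∫ x, α.inf' hα (fun a => (x - a) ^ 2) ∂P

/-- The `n`th quantization error `V_n(P)`, `n ≥ 1`: the infimum of the distortion errors of the
non-empty sets of at most `n` points. -/
def quantError (P : Measure ℝ) (n : ℕ) : ℝ :=
  sInf {v : ℝ | ∃ (α : Finset ℝ) (hα : α.Nonempty), α.card ≤ n ∧ distortion P α hα = v}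

/-- `L` is the `s`-dimensional quantization coefficient of `P`. -/
def HasQuantCoeff (P : Measure ℝ) (s L : ℝ) : Prop :=
  Filter.Tendsto (fun n : ℕ => (n : ℝ) ^ (2 / s) * quantError P n) Filter.atTop (nhds L)

/-- The dimension `β = log 3 / log 5`. -/
def β : ℝ := Real.log 3 / Real.log 5

/-- `f(x) = x^{2/β} ((2V - V₂) - x (V - V₂))`, where `V` is the variance of the triadic Cantor
distribution and `V₂` its second quantization error. -/
def f (x : ℝ) : ℝ :=
  x ^ (2 / β) *
    ((2 * ProbabilityTheory.variance id cantorDist - quantError cantorDist 2)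
      - x * (ProbabilityTheory.variance id cantorDist - quantError cantorDist 2))

end TriadicCantor

end

open MeasureTheory

noncomputable section

namespace TriadicCantor

/-! The core is that `V_n` is affine in `n` on each block: with `g = V - V₂`, `V_n = (V + g) / 25^l
- g n / 75^l` for `3^l ≤ n ≤ 2·3^l` (`quantError_eq_affine`). Since `3^(2/β) = 25`, this is (i).

Upper bound: point sets for the three pieces combine to `V_{a+b+c} ≤ (V_a + V_b + V_c) / 75`, and
`n` splits into three nearly equal parts. Lower bound, of Lagrangian type: at the price `g / 75^l`
per point, no finite set costs less than `(V + g) / 25^l` (`excess_nonneg`). By induction, the set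
is cut into the points serving each of the three pieces. The bounds for these add up, except that a
point serving two neighbouring pieces is paid for twice. Its distances to the two pieces, relative
to the gap, add up to 1, so it is remote from at least one of them, and the excess of remote pieces
covers the second payment (`charge_add_charge_le_excess` and its one-sided versions).

The value of `V₂` is never needed, only `1/50 ≤ V₂ ≤ 7/225`.

For (ii), `⌊x 3^l⌋ / 3^l → x` makes each `f x` with `x ∈ [1, 2]` an accumulation point, and `f` maps
`[1, 2]` onto an interval with minimum `f 1` (`f_one_le`). As `f (3/2) > f 1`, (iii) follows. -/

/-! ### Support, moments and symmetry of the Cantor distribution -/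

theorem cantorDist_eq_map_point :
    cantorDist = (Measure.infinitePi (fun _ : ℕ => digit)).map point := by
  refine selfSimilar_unique cantorDist_selfSimilar
    ⟨Measure.isProbabilityMeasure_map measurable_point.aemeasurable, ?_⟩
  conv_lhs => rw [infinitePi_digit_eq]
  rw [← Measure.mapₗ_apply_of_measurable measurable_point, map_sum]
  refine Finset.sum_congr rfl fun j _ => ?_
  rw [map_smul, Measure.mapₗ_apply_of_measurable measurable_point,
    Measure.map_map measurable_point (measurable_prep j),
    Measure.map_map (measurable_S j) measurable_point]
  congr 2
  funext w
  exact point_prep j w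

theorem point_mem_Icc (w : ℕ → Fin 3) : point w ∈ Set.Icc (0 : ℝ) 1 := by
  constructor
  · exact tsum_nonneg fun n => by positivity
  · have hg : HasSum (fun n : ℕ => (4 / 5 : ℝ) * (1 / 5) ^ n) 1 := by
      have := (hasSum_geometric_of_lt_one (r := (1 / 5 : ℝ)) (by norm_num) (by norm_num)).mul_left
        (4 / 5 : ℝ)
      rwa [show (4 / 5 : ℝ) * (1 - 1 / 5)⁻¹ = 1 by norm_num] at this
    rw [← hg.tsum_eq]
    refine Summable.tsum_le_tsum (fun n => ?_)
      (Summable.of_norm_bounded summable_bound fun n => term_bound w n) hg.summable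
    have h : ((w n : ℕ) : ℝ) ≤ 2 := by exact_mod_cast Nat.le_of_lt_succ (w n).2
    have h5 : (0 : ℝ) < (1 / 5) ^ n := by positivity
    rw [pow_succ]
    nlinarith

theorem ae_mem_Icc : ∀ᵐ x ∂cantorDist, x ∈ Set.Icc (0 : ℝ) 1 := by
  rw [cantorDist_eq_map_point]
  exact (ae_map_iff measurable_point.aemeasurable measurableSet_Icc).2
    (Filter.Eventually.of_forall point_mem_Icc)

theorem integrable_of_continuous {g : ℝ → ℝ} (hg : Continuous g) : Integrable g cantorDist := by
  have h : IntegrableOn g (Set.Icc 0 1) cantorDist :=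
    hg.continuousOn.integrableOn_compact isCompact_Icc
  rwa [IntegrableOn, Measure.restrict_eq_self_of_ae_mem ae_mem_Icc] at h

theorem continuous_S (j : Fin 3) : Continuous (S j) := by
  unfold S; fun_prop

theorem integral_selfSimilar {g : ℝ → ℝ} (hg : Continuous g) :
    ∫ x, g x ∂cantorDist = (∑ j : Fin 3, ∫ x, g (S j x) ∂cantorDist) / 3 := by
  have hint : ∀ j : Fin 3, Integrable g ((3 : ENNReal)⁻¹ • cantorDist.map (S j)) := by
    intro j
    refine Integrable.smul_measure ?_ (by simp)
    rw [integrable_map_measure hg.aestronglyMeasurable (measurable_S j).aemeasurable]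
    exact integrable_of_continuous (hg.comp (continuous_S j))
  conv_lhs => rw [cantorDist_selfSimilar.2]
  rw [integral_finsetSum_measure fun j _ => hint j, Finset.sum_div]
  refine Finset.sum_congr rfl fun j _ => ?_
  rw [integral_smul_measure, integral_map (measurable_S j).aemeasurable hg.aestronglyMeasurable]
  simp only [ENNReal.toReal_inv, ENNReal.toReal_ofNat, smul_eq_mul]
  ring

theorem integral_mono_Icc {g h : ℝ → ℝ} (hg : Continuous g) (hh : Continuous h)
    (hle : ∀ x ∈ Set.Icc (0 : ℝ) 1, g x ≤ h x) :
    ∫ x, g x ∂cantorDist ≤ ∫ x, h x ∂cantorDist :=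
  integral_mono_ae (integrable_of_continuous hg) (integrable_of_continuous hh)
    (ae_mem_Icc.mono fun x hx => hle x hx)

theorem integral_affine (c d : ℝ) :
    ∫ x, (c * x + d) ∂cantorDist = c * (∫ x, x ∂cantorDist) + d := by
  rw [integral_add (integrable_of_continuous (by fun_prop))
    (integrable_of_continuous (by fun_prop)), integral_const_mul]
  simp

theorem integral_id_cantorDist : ∫ x, x ∂cantorDist = 1 / 2 := by
  have h := integral_selfSimilar (g := fun x => x) (by fun_prop)
  have e : ∀ j : Fin 3, ∫ x, S j x ∂cantorDist
      = (1 / 5) * (∫ x, x ∂cantorDist) + 2 / 5 * ((j : ℕ) : ℝ) := by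
    intro j
    rw [← integral_affine]
    refine integral_congr_ae (Filter.Eventually.of_forall fun x => ?_)
    simp only [S]; ring
  simp only [e, Fin.sum_univ_three] at h
  norm_num at h
  linarith

theorem integral_quadratic (b c d : ℝ) :
    ∫ x, (b * x ^ 2 + c * x + d) ∂cantorDist
      = b * (∫ x, x ^ 2 ∂cantorDist) + c * (1 / 2) + d := by
  have h : ∀ x : ℝ, b * x ^ 2 + c * x + d = b * x ^ 2 + (c * x + d) := fun x => by ring
  simp only [h]
  rw [integral_add (integrable_of_continuous (by fun_prop))
    (integrable_of_continuous (by fun_prop)), integral_affine, integral_const_mul,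
    integral_id_cantorDist]
  ring

theorem integral_sq_cantorDist : ∫ x, x ^ 2 ∂cantorDist = 13 / 36 := by
  have h := integral_selfSimilar (g := fun x => x ^ 2) (by fun_prop)
  have e : ∀ j : Fin 3, ∫ x, S j x ^ 2 ∂cantorDist
      = (1 / 25) * (∫ x, x ^ 2 ∂cantorDist) + (4 / 25 * ((j : ℕ) : ℝ)) * (1 / 2)
        + 4 / 25 * ((j : ℕ) : ℝ) ^ 2 := by
    intro j
    rw [← integral_quadratic]
    refine integral_congr_ae (Filter.Eventually.of_forall fun x => ?_)
    simp only [S]; ring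
  simp only [e, Fin.sum_univ_three] at h
  norm_num at h
  linarith

/-- Moments of order at most two, in completed-square form. -/
theorem integral_completed_square (k r m : ℝ) :
    ∫ x, (k * (x - r) ^ 2 + m) ∂cantorDist = k * (1 / 9 + (r - 1 / 2) ^ 2) + m := by
  have h : ∀ x : ℝ, k * (x - r) ^ 2 + m = k * x ^ 2 + (-2 * k * r) * x + (k * r ^ 2 + m) :=
    fun x => by ring
  simp only [h]
  rw [integral_quadratic, integral_sq_cantorDist]
  ring

theorem integral_sub_sq (r : ℝ) :
    ∫ x, (x - r) ^ 2 ∂cantorDist = 1 / 9 + (r - 1 / 2) ^ 2 := by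
  simpa using integral_completed_square 1 r 0

theorem variance_cantorDist : ProbabilityTheory.variance id cantorDist = 1 / 9 := by
  rw [ProbabilityTheory.variance_eq_integral measurable_id.aemeasurable]
  simp only [id]
  rw [integral_id_cantorDist, integral_sub_sq]
  ring

/-- Reflection swaps `S 0` with `S 2` and commutes with `S 1`, so the image measure is again
self-similar and uniqueness applies. -/
theorem map_reflect_cantorDist : cantorDist.map (fun x => 1 - x) = cantorDist := by
  have hm : Measurable fun x : ℝ => 1 - x := by fun_prop
  refine selfSimilar_unique ⟨Measure.isProbabilityMeasure_map hm.aemeasurable, ?_⟩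
    cantorDist_selfSimilar
  conv_lhs => rw [cantorDist_selfSimilar.2]
  rw [← Measure.mapₗ_apply_of_measurable hm, map_sum]
  refine Fintype.sum_equiv Fin.revPerm _ _ fun j => ?_
  rw [map_smul, Measure.mapₗ_apply_of_measurable hm, Measure.map_map hm (measurable_S j),
    Measure.map_map (measurable_S _) hm]
  congr 2
  funext x
  fin_cases j <;> simp [S] <;> ring

theorem integral_reflect {g : ℝ → ℝ} (hg : Continuous g) :
    ∫ x, g (1 - x) ∂cantorDist = ∫ x, g x ∂cantorDist := by
  conv_rhs => rw [← map_reflect_cantorDist]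
  rw [integral_map (by fun_prop) hg.aestronglyMeasurable]

/-! ### Distortion -/

/-- The squared distance of `x` to the finite set `α`. -/
def sqDist (α : Finset ℝ) (hα : α.Nonempty) (x : ℝ) : ℝ := α.inf' hα fun a => (x - a) ^ 2

theorem continuous_sqDist (α : Finset ℝ) (hα : α.Nonempty) : Continuous (sqDist α hα) := by
  unfold sqDist
  exact Continuous.finset_inf'_apply hα fun a _ => by fun_prop

theorem sqDist_nonneg (α : Finset ℝ) (hα : α.Nonempty) (x : ℝ) : 0 ≤ sqDist α hα x :=
  Finset.le_inf' _ _ fun a _ => sq_nonneg (x - a)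

theorem distortion_nonneg (α : Finset ℝ) (hα : α.Nonempty) : 0 ≤ distortion cantorDist α hα :=
  integral_nonneg fun x => sqDist_nonneg α hα x

theorem distortion_eq_sum (α : Finset ℝ) (hα : α.Nonempty) :
    distortion cantorDist α hα = (∑ j : Fin 3, ∫ x, sqDist α hα (S j x) ∂cantorDist) / 3 :=
  integral_selfSimilar (continuous_sqDist α hα)

/-- The device for lower bounds on a piece: one quadratic below all squared distances has an
explicit integral; `k = 0` gives constant bounds. -/
theorem le_integral_sqDist_comp {α : Finset ℝ} {hα : α.Nonempty} {T : ℝ → ℝ} (hT : Continuous T)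
    (k r m : ℝ)
    (h : ∀ x ∈ Set.Icc (0 : ℝ) 1, ∀ a ∈ α, k * (x - r) ^ 2 + m ≤ (T x - a) ^ 2) :
    k * (1 / 9 + (r - 1 / 2) ^ 2) + m ≤ ∫ x, sqDist α hα (T x) ∂cantorDist := by
  rw [← integral_completed_square]
  exact integral_mono_Icc (by fun_prop) ((continuous_sqDist α hα).comp hT)
    fun x hx => Finset.le_inf' _ _ fun a ha => h x hx a ha

theorem integral_sqDist_comp_le {α : Finset ℝ} {hα : α.Nonempty} {T : ℝ → ℝ} (hT : Continuous T)
    {a : ℝ} (ha : a ∈ α) :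
    ∫ x, sqDist α hα (T x) ∂cantorDist ≤ ∫ x, (T x - a) ^ 2 ∂cantorDist :=
  integral_mono_Icc ((continuous_sqDist α hα).comp hT) (by fun_prop)
    fun x _ => Finset.inf'_le _ ha

theorem integral_S_sub_sq (j : Fin 3) (a : ℝ) :
    ∫ x, (S j x - a) ^ 2 ∂cantorDist = 1 / 225 + (1 / 10 + 2 / 5 * ((j : ℕ) : ℝ) - a) ^ 2 := by
  have h : ∀ x : ℝ, (S j x - a) ^ 2 = 1 / 25 * (x - 5 * (a - 2 / 5 * ((j : ℕ) : ℝ))) ^ 2 + 0 :=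
    fun x => by simp only [S]; ring
  simp only [h]
  rw [integral_completed_square]
  ring

theorem distortion_singleton (a : ℝ) (h : ({a} : Finset ℝ).Nonempty) :
    distortion cantorDist {a} h = 1 / 9 + (a - 1 / 2) ^ 2 := by
  simp [distortion, integral_sub_sq]

/-- The image of a finite set under `x ↦ 1 - x`. -/
def reflect (α : Finset ℝ) : Finset ℝ := α.image fun a => 1 - a

theorem mem_reflect {α : Finset ℝ} {a : ℝ} : a ∈ reflect α ↔ 1 - a ∈ α := by
  simp only [reflect, Finset.mem_image]
  constructor
  · rintro ⟨b, hb, rfl⟩; simpa using hb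
  · intro h; exact ⟨1 - a, h, by ring⟩

theorem card_reflect (α : Finset ℝ) : (reflect α).card = α.card :=
  Finset.card_image_of_injective _ fun a b h => by simpa using h

theorem reflect_nonempty {α : Finset ℝ} (hα : α.Nonempty) : (reflect α).Nonempty := hα.image _

theorem distortion_reflect (α : Finset ℝ) (hα : α.Nonempty) :
    distortion cantorDist (reflect α) (reflect_nonempty hα) = distortion cantorDist α hα := by
  refine (integral_reflect (continuous_sqDist _ (reflect_nonempty hα))).symm.trans ?_
  refine integral_congr_ae (Filter.Eventually.of_forall fun x => ?_)
  simp only [sqDist, reflect, Finset.inf'_image]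
  refine Finset.inf'_congr hα rfl fun a _ => ?_
  simp only [Function.comp]
  ring

/-! ### Quantization errors -/

theorem quantError_set_bddBelow (n : ℕ) :
    BddBelow {v : ℝ | ∃ (α : Finset ℝ) (hα : α.Nonempty), α.card ≤ n ∧
      distortion cantorDist α hα = v} :=
  ⟨0, by rintro v ⟨α, hα, -, rfl⟩; exact distortion_nonneg α hα⟩

theorem quantError_le {n : ℕ} (α : Finset ℝ) (hα : α.Nonempty) (h : α.card ≤ n) :
    quantError cantorDist n ≤ distortion cantorDist α hα :=
  csInf_le (quantError_set_bddBelow n) ⟨α, hα, h, rfl⟩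

theorem le_quantError {n : ℕ} (hn : 1 ≤ n) {b : ℝ}
    (h : ∀ (α : Finset ℝ) (hα : α.Nonempty), α.card ≤ n → b ≤ distortion cantorDist α hα) :
    b ≤ quantError cantorDist n := by
  refine le_csInf ⟨_, {0}, Finset.singleton_nonempty 0, by simpa using hn, rfl⟩ ?_
  rintro v ⟨α, hα, hc, rfl⟩
  exact h α hα hc

theorem exists_distortion_lt {n : ℕ} (hn : 1 ≤ n) {ε : ℝ} (hε : 0 < ε) :
    ∃ (α : Finset ℝ) (hα : α.Nonempty), α.card ≤ n ∧
      distortion cantorDist α hα < quantError cantorDist n + ε := by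
  obtain ⟨v, ⟨α, hα, hc, rfl⟩, hv⟩ := exists_lt_of_csInf_lt
    (s := {v : ℝ | ∃ (α : Finset ℝ) (hα : α.Nonempty), α.card ≤ n ∧
      distortion cantorDist α hα = v})
    ⟨_, {0}, Finset.singleton_nonempty 0, by simpa using hn, rfl⟩
    (lt_add_of_pos_right (quantError cantorDist n) hε)
  exact ⟨α, hα, hc, hv⟩

theorem quantError_one : quantError cantorDist 1 = 1 / 9 := by
  refine le_antisymm ?_ (le_quantError le_rfl fun α hα hc => ?_)
  · refine (quantError_le {1 / 2} (Finset.singleton_nonempty _) (by simp)).trans (le_of_eq ?_)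
    rw [distortion_singleton]; ring
  · obtain ⟨a, rfl⟩ := Finset.card_eq_one.1 (le_antisymm hc hα.card_pos)
    rw [distortion_singleton]
    nlinarith [sq_nonneg (a - 1 / 2)]

theorem quantError_two_le : quantError cantorDist 2 ≤ 7 / 225 := by
  -- `1/10` is the mean of the first piece, `7/10` the mean of the other two together.
  have hne : ({1 / 10, 7 / 10} : Finset ℝ).Nonempty := ⟨1 / 10, by simp⟩
  refine (quantError_le {1 / 10, 7 / 10} hne Finset.card_le_two).trans ?_
  rw [distortion_eq_sum, Fin.sum_univ_three]
  have h0 := integral_sqDist_comp_le (hα := hne) (continuous_S 0) (a := 1 / 10) (by simp)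
  have h1 := integral_sqDist_comp_le (hα := hne) (continuous_S 1) (a := 7 / 10) (by simp)
  have h2 := integral_sqDist_comp_le (hα := hne) (continuous_S 2) (a := 7 / 10) (by simp)
  rw [integral_S_sub_sq] at h0 h1 h2
  norm_num at h0 h1 h2 ⊢
  linarith

/-- `75 = 3 · 25`: each piece has weight `1/3` and squared contraction ratio `1/25`. -/
theorem quantError_add_add_le {a b c : ℕ} (ha : 1 ≤ a) (hb : 1 ≤ b) (hc : 1 ≤ c) :
    quantError cantorDist (a + b + c)
      ≤ (quantError cantorDist a + quantError cantorDist b + quantError cantorDist c) / 75 := by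
  refine le_of_forall_pos_le_add fun ε hε => ?_
  obtain ⟨α, hα, hαc, hαd⟩ := exists_distortion_lt ha hε
  obtain ⟨β', hβ, hβc, hβd⟩ := exists_distortion_lt hb hε
  obtain ⟨γ, hγ, hγc, hγd⟩ := exists_distortion_lt hc hε
  set U : Finset ℝ := α.image (S 0) ∪ β'.image (S 1) ∪ γ.image (S 2) with hU
  have hUc : U.card ≤ a + b + c := by
    refine (Finset.card_union_le _ _).trans (add_le_add ((Finset.card_union_le _ _).trans
      (add_le_add ?_ ?_)) ?_) <;> exact Finset.card_image_le.trans ‹_›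
  have hUne : U.Nonempty := by
    obtain ⟨x, hx⟩ := hα
    exact ⟨S 0 x, by simp only [hU, Finset.mem_union]
                     exact Or.inl (Or.inl (Finset.mem_image_of_mem _ hx))⟩
  refine (quantError_le U hUne hUc).trans ?_
  have key : ∀ (j : Fin 3) (δ : Finset ℝ) (hδ : δ.Nonempty), δ.image (S j) ⊆ U →
      ∫ x, sqDist U hUne (S j x) ∂cantorDist ≤ distortion cantorDist δ hδ / 25 := by
    intro j δ hδ hsub
    rw [distortion, ← integral_div]
    refine integral_mono_Icc ((continuous_sqDist _ _).comp (continuous_S j))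
      ((continuous_sqDist δ hδ).div_const 25) fun x _ => ?_
    obtain ⟨d, hd, hde⟩ := Finset.exists_mem_eq_inf' hδ fun a => (x - a) ^ 2
    rw [hde]
    refine (Finset.inf'_le _ (hsub (Finset.mem_image_of_mem _ hd))).trans (le_of_eq ?_)
    simp only [S]; ring
  rw [distortion_eq_sum, Fin.sum_univ_three]
  have h0 := key 0 α hα (Finset.subset_union_left.trans Finset.subset_union_left)
  have h1 := key 1 β' hβ (Finset.subset_union_right.trans Finset.subset_union_left)
  have h2 := key 2 γ hγ Finset.subset_union_right
  linarith

/-! ### Penalized distortion -/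

/-- The gain `V - V₂` of a second quantization point. -/
def gain : ℝ := 1 / 9 - quantError cantorDist 2

theorem gain_ge : 2 / 25 ≤ gain := by
  have := quantError_two_le
  unfold gain; linarith

theorem gain_le : gain ≤ 1 / 9 := by
  have := le_quantError (n := 2) (by norm_num) fun α hα _ => distortion_nonneg α hα
  unfold gain; linarith

/-- The amount by which `α` exceeds the lower bound `(1 / 9 + gain) / 25 ^ l` for the distortion
penalized by `gain / 75 ^ l` per point. -/
def excess (l : ℕ) (α : Finset ℝ) (hα : α.Nonempty) : ℝ :=
  distortion cantorDist α hα + gain / 75 ^ l * α.card - (1 / 9 + gain) / 25 ^ l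

theorem excess_zero (α : Finset ℝ) (hα : α.Nonempty) :
    excess 0 α hα = distortion cantorDist α hα + gain * α.card - 1 / 9 - gain := by
  simp only [excess, pow_zero, div_one]; ring

theorem excess_reflect (l : ℕ) (α : Finset ℝ) (hα : α.Nonempty) :
    excess l (reflect α) (reflect_nonempty hα) = excess l α hα := by
  rw [excess, excess, distortion_reflect, card_reflect]

/-- The point `c` belongs to `α` and all other points of `α` are at most `2 - c`, the reflection
of `c` in `1`. -/
def RightCrossed (α : Finset ℝ) (c : ℝ) : Prop := c ∈ α ∧ ∀ a ∈ α, a ≠ c → a ≤ 2 - c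

/-- The mirror image of `RightCrossed`. -/
def LeftCrossed (α : Finset ℝ) (b : ℝ) : Prop := b ∈ α ∧ ∀ a ∈ α, a ≠ b → -b ≤ a

theorem LeftCrossed.reflect {α : Finset ℝ} {b : ℝ} (h : LeftCrossed α b) :
    RightCrossed (reflect α) (1 - b) := by
  refine ⟨by rw [mem_reflect]; simpa using h.1, fun a ha hne => ?_⟩
  have := h.2 (1 - a) (mem_reflect.1 ha) fun e => hne (by linarith)
  linarith

theorem distortion_ge {α : Finset ℝ} {hα : α.Nonempty} {A B C : ℝ}
    (h0 : A ≤ ∫ x, sqDist α hα (S 0 x) ∂cantorDist)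
    (h1 : B ≤ ∫ x, sqDist α hα (S 1 x) ∂cantorDist)
    (h2 : C ≤ ∫ x, sqDist α hα (S 2 x) ∂cantorDist) :
    (A + B + C) / 3 ≤ distortion cantorDist α hα := by
  rw [distortion_eq_sum, Fin.sum_univ_three]; linarith

theorem integral_sqDist_nonneg {α : Finset ℝ} {hα : α.Nonempty} (j : Fin 3) :
    0 ≤ ∫ x, sqDist α hα (S j x) ∂cantorDist :=
  integral_nonneg fun _ => sqDist_nonneg α hα _

theorem S_zero (x : ℝ) : S 0 x = x / 5 := by simp [S]

theorem S_one (x : ℝ) : S 1 x = x / 5 + 2 / 5 := by simp [S]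

theorem S_two (x : ℝ) : S 2 x = x / 5 + 4 / 5 := by simp [S]; norm_num

/-! ### Distortion of sets with a remote extreme point -/

theorem RightCrossed.le_distortion {α : Finset ℝ} (hα : α.Nonempty) {c : ℝ}
    (h : RightCrossed α c) (hc : 7 / 5 ≤ c) : 17 / 540 ≤ distortion cantorDist α hα := by
  -- At `S 2 x` the point `c` is at distance at least `(3 - x)/5 ≥ (x + 1)/5`, and the other points,
  -- being at most `3/5`, are at distance at least `(x + 1)/5`.
  have h2 := le_integral_sqDist_comp (hα := hα) (continuous_S 2) (1 / 25) (-1) 0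
    (fun x hx a ha => by
      rw [S_two]
      obtain ⟨hx0, hx1⟩ := hx
      by_cases hac : a = c
      · subst hac; nlinarith
      · have := h.2 a ha hac
        nlinarith)
  refine le_trans ?_ (distortion_ge (integral_sqDist_nonneg 0) (integral_sqDist_nonneg 1) h2)
  norm_num

/-- A pair whose left point lies far to the left has a large distortion. -/
theorem distortion_pair_of_lt {a c : ℝ} (hne : ({a, c} : Finset ℝ).Nonempty) (hc : 7 / 5 ≤ c)
    (ha : a < -(1 / 5)) : 1 / 9 ≤ distortion cantorDist {a, c} hne := by
  have h1 := le_integral_sqDist_comp (hα := hne) (continuous_S 1) 0 0 (9 / 25)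
    (fun x hx y hy => by
      rw [S_one]
      obtain ⟨hx0, hx1⟩ := hx
      rcases Finset.mem_insert.1 hy with rfl | hy
      · nlinarith
      · rw [Finset.mem_singleton.1 hy]; nlinarith)
  refine le_trans ?_ (distortion_ge (integral_sqDist_nonneg 0) h1 (integral_sqDist_nonneg 2))
  norm_num

theorem le_integral_sqDist_pair {a c : ℝ} (hne : ({a, c} : Finset ℝ).Nonempty) (j : Fin 3)
    (h : ∀ x ∈ Set.Icc (0 : ℝ) 1, 2 * S j x ≤ a + c) (hac : a ≤ c) :
    1 / 225 + (1 / 10 + 2 / 5 * ((j : ℕ) : ℝ) - a) ^ 2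
      ≤ ∫ x, sqDist {a, c} hne (S j x) ∂cantorDist := by
  rw [← integral_S_sub_sq]
  refine integral_mono_Icc (by have := continuous_S j; fun_prop)
    ((continuous_sqDist _ _).comp (continuous_S j)) fun x hx => Finset.le_inf' _ _ fun y hy => ?_
  rcases Finset.mem_insert.1 hy with rfl | hy
  · exact le_rfl
  · rw [Finset.mem_singleton.1 hy]
    nlinarith [h x hx]

theorem distortion_pair_ge {a c : ℝ} (hne : ({a, c} : Finset ℝ).Nonempty) (hc : 7 / 5 ≤ c)
    (ha : -(1 / 5) ≤ a) (hac : a ≤ c) {B : ℝ}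
    (hB : B ≤ ∫ x, sqDist {a, c} hne (S 2 x) ∂cantorDist) :
    (2 / 225 + (1 / 10 - a) ^ 2 + (1 / 2 - a) ^ 2 + B) / 3 ≤ distortion cantorDist {a, c} hne := by
  have h0 := le_integral_sqDist_pair hne 0 (fun x hx => by
    rw [S_zero]; linarith [hx.1, hx.2]) hac
  have h1 := le_integral_sqDist_pair hne 1 (fun x hx => by
    rw [S_one]; linarith [hx.1, hx.2]) hac
  refine le_trans (le_of_eq ?_) (distortion_ge h0 h1 hB)
  norm_num
  ring

theorem distortion_pair_far {a c : ℝ} (hne : ({a, c} : Finset ℝ).Nonempty) (hc : 8 / 5 ≤ c)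
    (hac : a ≤ 2 - c) : 1 / 9 ≤ distortion cantorDist {a, c} hne := by
  rcases lt_or_ge a (-(1 / 5)) with ha | ha
  · exact distortion_pair_of_lt hne (by linarith) ha
  have h2 := le_integral_sqDist_comp (hα := hne) (continuous_S 2) (1 / 25) (-2) 0
    (fun x hx y hy => by
      rw [S_two]
      obtain ⟨hx0, hx1⟩ := hx
      rcases Finset.mem_insert.1 hy with rfl | hy
      · nlinarith
      · rw [Finset.mem_singleton.1 hy]; nlinarith)
  refine le_trans ?_ (distortion_pair_ge hne (by linarith) ha (by linarith) h2)
  nlinarith [sq_nonneg (a - 3 / 10)]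

theorem distortion_pair_near {a c : ℝ} (hne : ({a, c} : Finset ℝ).Nonempty) (hc : 7 / 5 ≤ c)
    (hac : a ≤ 2 - c) : 1 / 9 - 1 / 25 ≤ distortion cantorDist {a, c} hne := by
  rcases lt_or_ge a (-(1 / 5)) with ha | ha
  · exact le_trans (by norm_num) (distortion_pair_of_lt hne (by linarith) ha)
  rcases le_total a (2 / 5) with h4 | h4
  · have h2 := le_integral_sqDist_comp (hα := hne) (continuous_S 2) 0 0 (4 / 25)
      (fun x hx y hy => by
        rw [S_two]
        obtain ⟨hx0, hx1⟩ := hx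
        rcases Finset.mem_insert.1 hy with rfl | hy
        · nlinarith
        · rw [Finset.mem_singleton.1 hy]; nlinarith)
    refine le_trans ?_ (distortion_pair_ge hne (by linarith) ha (by linarith) h2)
    nlinarith [sq_nonneg (a - 3 / 10)]
  · have h2 := le_integral_sqDist_comp (hα := hne) (continuous_S 2) 0 0 ((4 / 5 - a) ^ 2)
      (fun x hx y hy => by
        rw [S_two]
        obtain ⟨hx0, hx1⟩ := hx
        rcases Finset.mem_insert.1 hy with rfl | hy
        · nlinarith
        · rw [Finset.mem_singleton.1 hy]; nlinarith)
    refine le_trans ?_ (distortion_pair_ge hne (by linarith) ha (by linarith) h2)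
    -- `7/15` is the mean of `1/10`, `1/2` and `4/5`, hence minimizes the sum of the three squares.
    nlinarith [sq_nonneg (a - 7 / 15)]

theorem distortion_pair_both {b c : ℝ} (hne : ({b, c} : Finset ℝ).Nonempty) (hc : 7 / 5 ≤ c)
    (hb : b ≤ -(2 / 5)) : 8 / 25 ≤ distortion cantorDist {b, c} hne := by
  have key : ∀ (j : Fin 3) (m : ℝ),
      (∀ x ∈ Set.Icc (0 : ℝ) 1, m ≤ (S j x - b) ^ 2 ∧ m ≤ (S j x - c) ^ 2) →
      m ≤ ∫ x, sqDist {b, c} hne (S j x) ∂cantorDist := by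
    intro j m h
    have := le_integral_sqDist_comp (hα := hne) (continuous_S j) 0 0 m (fun x hx y hy => by
      rw [zero_mul, zero_add]
      rcases Finset.mem_insert.1 hy with rfl | hy
      · exact (h x hx).1
      · rw [Finset.mem_singleton.1 hy]; exact (h x hx).2)
    simpa using this
  have h0 := key 0 (4 / 25) fun x hx => by
    rw [S_zero]; constructor <;> nlinarith [hx.1, hx.2]
  have h1 := key 1 (16 / 25) fun x hx => by
    rw [S_one]; constructor <;> nlinarith [hx.1, hx.2]
  have h2 := key 2 (4 / 25) fun x hx => by
    rw [S_two]; constructor <;> nlinarith [hx.1, hx.2]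
  refine le_trans ?_ (distortion_ge h0 h1 h2)
  norm_num

/-! ### Charging the price of a shared point -/

/-- The share of the penalty for a point in a gap which is charged to the side at relative
distance `t` from it. -/
def charge (t : ℝ) : ℝ := if 3 / 5 < t then 1 else if 2 / 5 ≤ t then 1 / 2 else 0

theorem charge_le_one (t : ℝ) : charge t ≤ 1 := by
  unfold charge; split_ifs <;> norm_num

theorem charge_of_lt {t : ℝ} (h : t < 2 / 5) : charge t = 0 := by
  unfold charge; rw [if_neg (by linarith), if_neg (by linarith)]

theorem charge_of_le {t : ℝ} (h : 2 / 5 ≤ t) (h' : t ≤ 3 / 5) : charge t = 1 / 2 := by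
  unfold charge; rw [if_neg (by linarith), if_pos h]

theorem one_le_charge_add {s t : ℝ} (h : s + t = 1) : 1 ≤ charge s + charge t := by
  unfold charge
  split_ifs <;> first | (norm_num; done) | (exfalso; linarith)

/-- At positive levels a distortion of `17 / 540` is prohibitive. -/
theorem le_excess_succ {l : ℕ} {α : Finset ℝ} {hα : α.Nonempty}
    (h : 17 / 540 ≤ distortion cantorDist α hα) :
    gain / 75 ^ (l + 1) * 2 ≤ excess (l + 1) α hα := by
  have hL := gain_ge
  have hL' := gain_le
  have h25 : (25 : ℝ) ≤ 25 ^ (l + 1) := le_self_pow₀ (by norm_num) (by simp)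
  have h75 : (75 : ℝ) ≤ 75 ^ (l + 1) := le_self_pow₀ (by norm_num) (by simp)
  have e1 : gain / 75 ^ (l + 1) ≤ (1 / 9) / 75 := by gcongr
  have e2 : (1 / 9 + gain) / 25 ^ (l + 1) ≤ (1 / 9 + 1 / 9) / 25 := by gcongr
  have e3 : 0 ≤ gain / 75 ^ (l + 1) * α.card := by positivity
  unfold excess
  linarith

theorem excess_zero_ge {α : Finset ℝ} {hα : α.Nonempty} {k : ℕ} (hk : k ≤ α.card) :
    distortion cantorDist α hα + gain * k - 1 / 9 - gain ≤ excess 0 α hα := by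
  rw [excess_zero]
  have : (k : ℝ) ≤ α.card := by exact_mod_cast hk
  nlinarith [gain_ge]

theorem RightCrossed.charge_le_excess {l : ℕ} {α : Finset ℝ} (hα : α.Nonempty) {c : ℝ}
    (h : RightCrossed α c) (h0 : 0 ≤ excess l α hα) :
    gain / 75 ^ l * charge (c - 1) ≤ excess l α hα := by
  have hL := gain_ge
  have hL' := gain_le
  rcases lt_or_ge (c - 1) (2 / 5) with hc | hc
  · rw [charge_of_lt hc, mul_zero]; exact h0
  have hD := h.le_distortion hα (by linarith)
  have hch := charge_le_one (c - 1)
  cases l with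
  | succ l =>
    refine le_trans ?_ (le_excess_succ hD)
    gcongr
    linarith
  | zero =>
    rw [pow_zero, div_one]
    rcases Nat.lt_or_ge 2 α.card with h3 | h3
    -- Three points suffice because `17/540 + 2/25 ≥ 1/9`, with a margin of only `1/2700`.
    · have := excess_zero_ge (hα := hα) h3
      push_cast at this
      nlinarith
    rcases Nat.lt_or_ge 1 α.card with h2 | h2
    · have hc2 : α.card = 2 := by omega
      obtain ⟨a, ha, hac⟩ := Finset.exists_mem_ne h2 c
      have hle := h.2 a ha hac
      have hα' : α = {a, c} := by
        refine (Finset.eq_of_subset_of_card_le ?_ ?_).symm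
        · intro y hy
          rcases Finset.mem_insert.1 hy with rfl | hy
          · exact ha
          · rw [Finset.mem_singleton.1 hy]; exact h.1
        · rw [hc2, Finset.card_pair hac]
      have he := excess_zero_ge (hα := hα) hc2.ge
      push_cast at he
      subst hα'
      rcases lt_or_ge (3 / 5) (c - 1) with hc' | hc'
      · have := distortion_pair_far hα (by linarith) hle
        nlinarith
      · have := distortion_pair_near hα (by linarith) hle
        -- Half the price is affordable: `gain - 1/25 ≥ gain/2` is exactly `gain ≥ 2/25`.
        rw [charge_of_le hc hc']
        linarith
    · obtain ⟨a, rfl⟩ := Finset.card_eq_one.1 (le_antisymm h2 hα.card_pos)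
      have hca := Finset.mem_singleton.1 h.1
      subst hca
      rw [excess_zero, distortion_singleton]
      simp
      nlinarith

theorem LeftCrossed.charge_le_excess {l : ℕ} {α : Finset ℝ} (hα : α.Nonempty) {b : ℝ}
    (h : LeftCrossed α b) (h0 : 0 ≤ excess l α hα) :
    gain / 75 ^ l * charge (-b) ≤ excess l α hα := by
  have := h.reflect.charge_le_excess (l := l) (reflect_nonempty hα) (by rwa [excess_reflect])
  rwa [excess_reflect, show 1 - b - 1 = -b by ring] at this

theorem charge_add_charge_le_excess {l : ℕ} {α : Finset ℝ} (hα : α.Nonempty) {b c : ℝ}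
    (hb : LeftCrossed α b) (hc : RightCrossed α c) (h0 : 0 ≤ excess l α hα) :
    gain / 75 ^ l * (charge (-b) + charge (c - 1)) ≤ excess l α hα := by
  have hL := gain_ge
  have hL' := gain_le
  rcases lt_or_ge (c - 1) (2 / 5) with hc' | hc'
  · rw [charge_of_lt hc', add_zero]; exact hb.charge_le_excess hα h0
  rcases lt_or_ge (-b) (2 / 5) with hb' | hb'
  · rw [charge_of_lt hb', zero_add]; exact hc.charge_le_excess hα h0
  have hD := hc.le_distortion hα (by linarith)
  have hch := charge_le_one (c - 1)
  have hch' := charge_le_one (-b)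
  have hbc : b ≠ c := by intro e; linarith
  have hsub : ({b, c} : Finset ℝ) ⊆ α := by
    intro y hy
    rcases Finset.mem_insert.1 hy with rfl | hy
    · exact hb.1
    · rw [Finset.mem_singleton.1 hy]; exact hc.1
  cases l with
  | succ l =>
    refine le_trans ?_ (le_excess_succ hD)
    gcongr
    linarith
  | zero =>
    rw [pow_zero, div_one]
    have hcard := Finset.card_le_card hsub
    rcases Nat.lt_or_ge ({b, c} : Finset ℝ).card α.card with h3 | h3
    · obtain ⟨a, ha, hna⟩ := Finset.exists_mem_notMem_of_card_lt_card h3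
      simp only [Finset.mem_insert, Finset.mem_singleton, not_or] at hna
      have h1 := hb.2 a ha hna.1
      have h2 := hc.2 a ha hna.2
      -- A third point lies between `-b` and `2 - c`, so `(c - 1) + (-b) ≤ 1`. Both terms are at
      -- least `2/5`, hence at most `3/5`, and the total charge is only 1.
      rw [charge_of_le hc' (by linarith), charge_of_le hb' (by linarith)]
      rw [Finset.card_pair hbc] at h3
      have := excess_zero_ge (hα := hα) h3
      push_cast at this
      linarith
    · have hα' := Finset.eq_of_subset_of_card_le hsub h3
      subst hα'
      have := excess_zero_ge (hα := hα) (Finset.card_pair hbc).ge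
      have hp := distortion_pair_both hα (by linarith) (by linarith)
      push_cast at this
      nlinarith

/-! ### The lower bound -/

theorem excess_zero_nonneg (α : Finset ℝ) (hα : α.Nonempty) : 0 ≤ excess 0 α hα := by
  have hL := gain_ge
  have hD := distortion_nonneg α hα
  rcases Nat.lt_or_ge 2 α.card with h3 | h3
  · have := excess_zero_ge (hα := hα) h3
    push_cast at this
    linarith
  rcases Nat.lt_or_ge 1 α.card with h2 | h2
  · have := excess_zero_ge (hα := hα) h2
    have hq := quantError_le α hα h3
    unfold gain at *
    push_cast at this
    linarith
  · have := excess_zero_ge (hα := hα) hα.card_pos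
    have hq := quantError_le α hα h2
    rw [quantError_one] at hq
    push_cast at this
    linarith

/-! ### Cutting a set into the points serving each piece -/

theorem exists_nearest {α : Finset ℝ} (hα : α.Nonempty) (p : ℝ) :
    ∃ u ∈ α, ∀ a ∈ α, (p - u) ^ 2 ≤ (p - a) ^ 2 :=
  α.exists_min_image (fun a => (p - a) ^ 2) hα

/-- `y ↦ 5 y - 2 j` inverts `S j`. A subset `δ` that serves the piece as well as `α` does can be
blown up to a competitor for the whole distribution. -/
theorem distortion_image_le {α δ : Finset ℝ} {hα : α.Nonempty} (j : Fin 3)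
    (hδ : (δ.image fun y => 5 * y - 2 * ((j : ℕ) : ℝ)).Nonempty)
    (h : ∀ x ∈ Set.Icc (0 : ℝ) 1, ∀ a ∈ α, ∃ d ∈ δ, (S j x - d) ^ 2 ≤ (S j x - a) ^ 2) :
    distortion cantorDist (δ.image fun y => 5 * y - 2 * ((j : ℕ) : ℝ)) hδ
      ≤ 25 * ∫ x, sqDist α hα (S j x) ∂cantorDist := by
  rw [distortion, ← integral_const_mul]
  refine integral_mono_Icc (continuous_sqDist _ hδ)
    (((continuous_sqDist _ _).comp (continuous_S j)).const_mul 25) fun x hx => ?_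
  obtain ⟨a, ha, hae⟩ := Finset.exists_mem_eq_inf' hα fun a => (S j x - a) ^ 2
  obtain ⟨d, hd, hle⟩ := h x hx a ha
  rw [sqDist, hae]
  refine (Finset.inf'_le _ (Finset.mem_image_of_mem _ hd)).trans ?_
  refine le_trans (le_of_eq ?_) (mul_le_mul_of_nonneg_left hle (by norm_num : (0 : ℝ) ≤ 25))
  simp only [S]; ring

theorem card_image_scale (δ : Finset ℝ) (j : Fin 3) :
    (δ.image fun y => 5 * y - 2 * ((j : ℕ) : ℝ)).card = δ.card :=
  Finset.card_image_of_injective _ fun a b h => by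
    have : 5 * a - 2 * ((j : ℕ) : ℝ) = 5 * b - 2 * ((j : ℕ) : ℝ) := h
    linarith

/-- `(x - a)² - (x - u)²` is affine in `x` and nonincreasing when `u ≤ a`. -/
theorem sq_le_of_right {u a p x : ℝ} (h : (p - u) ^ 2 ≤ (p - a) ^ 2) (ha : u ≤ a) (hx : x ≤ p) :
    (x - u) ^ 2 ≤ (x - a) ^ 2 := by
  nlinarith [mul_nonneg (sub_nonneg.2 ha) (sub_nonneg.2 hx)]

theorem sq_le_of_left {u a p x : ℝ} (h : (p - u) ^ 2 ≤ (p - a) ^ 2) (ha : a ≤ u) (hx : p ≤ x) :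
    (x - u) ^ 2 ≤ (x - a) ^ 2 := by
  nlinarith [mul_nonneg (sub_nonneg.2 ha) (sub_nonneg.2 hx)]

theorem nearest_mono {u v p q : ℝ} (hpq : p < q) (h1 : (p - u) ^ 2 ≤ (p - v) ^ 2)
    (h2 : (q - v) ^ 2 ≤ (q - u) ^ 2) : u ≤ v := by
  by_contra! h
  nlinarith [mul_pos (sub_pos.2 hpq) (sub_pos.2 h)]

/-- `w` is nearest to the right end of the piece, so the points left of `w` lie beyond its mirror
image in that end; blown up, the end becomes 1. -/
theorem rightCrossed_image {α δ : Finset ℝ} {j : Fin 3} {w : ℝ} (hw : w ∈ δ)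
    (hδ : ∀ y ∈ δ, y ∈ α ∧ y ≤ w)
    (h : ∀ a ∈ α, (1 / 5 + 2 / 5 * ((j : ℕ) : ℝ) - w) ^ 2
      ≤ (1 / 5 + 2 / 5 * ((j : ℕ) : ℝ) - a) ^ 2) :
    RightCrossed (δ.image fun y => 5 * y - 2 * ((j : ℕ) : ℝ)) (5 * w - 2 * ((j : ℕ) : ℝ)) := by
  refine ⟨Finset.mem_image_of_mem _ hw, fun a ha hne => ?_⟩
  obtain ⟨y, hy, rfl⟩ := Finset.mem_image.1 ha
  have hyw : y < w := lt_of_le_of_ne (hδ y hy).2 fun e => hne (by rw [e])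
  have := h y (hδ y hy).1
  by_contra! hcon
  nlinarith

theorem leftCrossed_image {α δ : Finset ℝ} {j : Fin 3} {w : ℝ} (hw : w ∈ δ)
    (hδ : ∀ y ∈ δ, y ∈ α ∧ w ≤ y)
    (h : ∀ a ∈ α, (2 / 5 * ((j : ℕ) : ℝ) - w) ^ 2 ≤ (2 / 5 * ((j : ℕ) : ℝ) - a) ^ 2) :
    LeftCrossed (δ.image fun y => 5 * y - 2 * ((j : ℕ) : ℝ)) (5 * w - 2 * ((j : ℕ) : ℝ)) := by
  refine ⟨Finset.mem_image_of_mem _ hw, fun a ha hne => ?_⟩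
  obtain ⟨y, hy, rfl⟩ := Finset.mem_image.1 ha
  have hyw : w < y := lt_of_le_of_ne (hδ y hy).2 fun e => hne (by rw [e])
  have := h y (hδ y hy).1
  by_contra! hcon
  nlinarith

/-- Only a point serving both ends of a gap is counted repeatedly; points strictly between `u` and
`v`, or `w` and `z`, are not counted at all. -/
theorem card_filter_add_le (α : Finset ℝ) {u v w z : ℝ} (huv : u ≤ v) (hvw : v ≤ w)
    (hwz : w ≤ z) :
    ((α.filter (· ≤ u)).card : ℝ) + (α.filter fun a => v ≤ a ∧ a ≤ w).card
        + (α.filter (z ≤ ·)).card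
      ≤ α.card + (if u = v then 1 else 0) + if w = z then 1 else 0 := by
  have h1 : ∑ a ∈ α, (if u = v ∧ a = u then (1 : ℝ) else 0) ≤ if u = v then 1 else 0 := by
    split_ifs with h
    · simp only [h, true_and, Finset.sum_ite_eq']; split_ifs <;> norm_num
    · simp [h]
  have h2 : ∑ a ∈ α, (if w = z ∧ a = w then (1 : ℝ) else 0) ≤ if w = z then 1 else 0 := by
    split_ifs with h
    · simp only [h, true_and, Finset.sum_ite_eq']; split_ifs <;> norm_num
    · simp [h]
  have h3 : ∑ a ∈ α, ((if a ≤ u then (1 : ℝ) else 0) + (if v ≤ a ∧ a ≤ w then 1 else 0)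
        + if z ≤ a then 1 else 0)
      ≤ ∑ a ∈ α, (1 + (if u = v ∧ a = u then (1 : ℝ) else 0)
        + if w = z ∧ a = w then (1 : ℝ) else 0) := by
    refine Finset.sum_le_sum fun a _ => ?_
    split_ifs <;> first | (norm_num; done) | (exfalso; grind)
  simp only [Finset.sum_add_distrib, Finset.sum_boole, Finset.sum_const, nsmul_eq_mul,
    mul_one] at h1 h2 h3
  linarith

theorem excess_nonneg (l : ℕ) : ∀ (α : Finset ℝ) (hα : α.Nonempty), 0 ≤ excess l α hα := by
  induction l with
  | zero => exact excess_zero_nonneg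
  | succ l ih =>
    intro α hα
    -- The ends of the two gaps. The points nearest to them delimit what each piece can use.
    obtain ⟨u, huα, hu⟩ := exists_nearest hα (1 / 5)
    obtain ⟨v, hvα, hv⟩ := exists_nearest hα (2 / 5)
    obtain ⟨w, hwα, hw⟩ := exists_nearest hα (3 / 5)
    obtain ⟨z, hzα, hz⟩ := exists_nearest hα (4 / 5)
    have huv : u ≤ v := nearest_mono (by norm_num) (hu v hvα) (hv u huα)
    have hvw : v ≤ w := nearest_mono (by norm_num) (hv w hwα) (hw v hvα)
    have hwz : w ≤ z := nearest_mono (by norm_num) (hw z hzα) (hz w hwα)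
    set A := α.filter (· ≤ u) with hA
    set B := α.filter (fun a => v ≤ a ∧ a ≤ w) with hB
    set C := α.filter (z ≤ ·) with hC
    have huA : u ∈ A := by simp [hA, huα]
    have hvB : v ∈ B := by simp [hB, hvα, hvw]
    have hwB : w ∈ B := by simp [hB, hwα, hvw]
    have hzC : z ∈ C := by simp [hC, hzα]
    have hA' : ∀ y ∈ A, y ∈ α ∧ y ≤ u := fun y hy => by simpa [hA] using hy
    have hB' : ∀ y ∈ B, y ∈ α ∧ v ≤ y ∧ y ≤ w := fun y hy => by simpa [hB] using hy
    have hC' : ∀ y ∈ C, y ∈ α ∧ z ≤ y := fun y hy => by simpa [hC] using hy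
    have nA : (A.image fun y => 5 * y - 2 * (((0 : Fin 3) : ℕ) : ℝ)).Nonempty :=
      ⟨_, Finset.mem_image_of_mem _ huA⟩
    have nB : (B.image fun y => 5 * y - 2 * (((1 : Fin 3) : ℕ) : ℝ)).Nonempty :=
      ⟨_, Finset.mem_image_of_mem _ hvB⟩
    have nC : (C.image fun y => 5 * y - 2 * (((2 : Fin 3) : ℕ) : ℝ)).Nonempty :=
      ⟨_, Finset.mem_image_of_mem _ hzC⟩
    have dA := distortion_image_le (hα := hα) 0 nA fun x hx a ha => by
      rw [S_zero]
      rcases le_total a u with h | h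
      · exact ⟨a, by simp [hA, ha, h], le_rfl⟩
      · exact ⟨u, huA, sq_le_of_right (hu a ha) h (by linarith [hx.2])⟩
    have dB := distortion_image_le (hα := hα) 1 nB fun x hx a ha => by
      rw [S_one]
      rcases lt_or_ge a v with h | h
      · exact ⟨v, hvB, sq_le_of_left (hv a ha) h.le (by linarith [hx.1])⟩
      rcases le_total a w with h' | h'
      · exact ⟨a, by simp [hB, ha, h, h'], le_rfl⟩
      · exact ⟨w, hwB, sq_le_of_right (hw a ha) h' (by linarith [hx.2])⟩
    have dC := distortion_image_le (hα := hα) 2 nC fun x hx a ha => by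
      rw [S_two]
      rcases le_total z a with h | h
      · exact ⟨a, by simp [hC, ha, h], le_rfl⟩
      · exact ⟨z, hzC, sq_le_of_left (hz a ha) h (by linarith [hx.1])⟩
    have eA := ih _ nA
    have eB := ih _ nB
    have eC := ih _ nC
    have rA : RightCrossed _ _ := rightCrossed_image (j := 0) huA hA' (by simpa using hu)
    have rB : RightCrossed _ _ := rightCrossed_image (j := 1) hwB
      (fun y hy => ⟨(hB' y hy).1, (hB' y hy).2.2⟩) (by norm_num at hw ⊢; exact hw)
    have lB : LeftCrossed _ _ := leftCrossed_image (j := 1) hvB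
      (fun y hy => ⟨(hB' y hy).1, (hB' y hy).2.1⟩) (by norm_num at hv ⊢; exact hv)
    have lC : LeftCrossed _ _ := leftCrossed_image (j := 2) hzC hC'
      (by norm_num at hz ⊢; exact hz)
    have fA := rA.charge_le_excess nA eA
    have fB := rB.charge_le_excess nB eB
    have fB' := lB.charge_le_excess nB eB
    -- The middle piece may be charged from both sides, and its single excess must cover the sum.
    have fB2 := charge_add_charge_le_excess nB lB rB eB
    have fC := lC.charge_le_excess nC eC
    have hL : 0 < gain / 75 ^ l := div_pos (by linarith [gain_ge]) (by positivity)
    -- The excesses of the pieces pay for every repeated count; the rest is the self-similar scaling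
    -- by 75.
    have total : gain / 75 ^ l * ((if u = v then 1 else 0) + if w = z then 1 else 0)
        ≤ excess l _ nA + excess l _ nB + excess l _ nC := by
      have c1 : u = v → 1 ≤ charge (5 * u - 2 * (((0 : Fin 3) : ℕ) : ℝ) - 1)
          + charge (-(5 * v - 2 * (((1 : Fin 3) : ℕ) : ℝ))) := by
        -- Relative distances of the shared point: `(5 u - 1) + (2 - 5 u) = 1`.
        rintro rfl; apply one_le_charge_add; norm_num
      have c2 : w = z → 1 ≤ charge (5 * w - 2 * (((1 : Fin 3) : ℕ) : ℝ) - 1)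
          + charge (-(5 * z - 2 * (((2 : Fin 3) : ℕ) : ℝ))) := by
        rintro rfl; apply one_le_charge_add; norm_num; ring
      split_ifs with h1 h2 h2
      · have := mul_le_mul_of_nonneg_left (c1 h1) hL.le
        have := mul_le_mul_of_nonneg_left (c2 h2) hL.le
        linarith
      · have := mul_le_mul_of_nonneg_left (c1 h1) hL.le
        linarith
      · have := mul_le_mul_of_nonneg_left (c2 h2) hL.le
        linarith
      · linarith
    have hcard := mul_le_mul_of_nonneg_left (card_filter_add_le α huv hvw hwz) hL.le
    rw [← hA, ← hB, ← hC] at hcard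
    simp only [excess, card_image_scale] at total
    have hD := distortion_eq_sum α hα
    rw [Fin.sum_univ_three] at hD
    have e1 : gain / 75 ^ (l + 1) = gain / 75 ^ l / 75 := by rw [pow_succ, div_div]
    have e2 : (1 / 9 + gain) / 25 ^ (l + 1) = (1 / 9 + gain) / 25 ^ l / 25 := by
      rw [pow_succ, div_div]
    rw [excess, e1, e2, hD]
    linarith

/-! ### The exact quantization errors -/

theorem quantError_le_affine (l : ℕ) : ∀ n : ℕ, 3 ^ l ≤ n → n ≤ 2 * 3 ^ l →
    quantError cantorDist n ≤ (1 / 9 + gain) / 25 ^ l - gain / 75 ^ l * n := by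
  induction l with
  | zero =>
    intro n h1 h2
    have h : n = 1 ∨ n = 2 := by simp at h1 h2; omega
    rcases h with rfl | rfl
    · rw [quantError_one]; simp
    · simp [gain]; linarith
  | succ l ih =>
    intro n h1 h2
    rw [pow_succ] at h1 h2
    have hpos : 1 ≤ 3 ^ l := Nat.one_le_pow _ _ (by norm_num)
    -- The three nearly equal parts of `n` all stay in `[3^l, 2·3^l]`.
    obtain ⟨a, ha⟩ : ∃ a, a = n / 3 := ⟨_, rfl⟩
    obtain ⟨b, hb⟩ : ∃ b, b = (n + 1) / 3 := ⟨_, rfl⟩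
    obtain ⟨c, hc⟩ : ∃ c, c = (n + 2) / 3 := ⟨_, rfl⟩
    have hn : n = a + b + c := by omega
    have q := quantError_add_add_le (a := a) (b := b) (c := c) (by omega) (by omega) (by omega)
    have qa := ih a (by omega) (by omega)
    have qb := ih b (by omega) (by omega)
    have qc := ih c (by omega) (by omega)
    rw [hn]
    push_cast
    have e1 : gain / 75 ^ (l + 1) = gain / 75 ^ l / 75 := by rw [pow_succ, div_div]
    have e2 : (1 / 9 + gain) / 25 ^ (l + 1) = (1 / 9 + gain) / 25 ^ l / 25 := by
      rw [pow_succ, div_div]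
    rw [e1, e2]
    linarith

theorem quantError_eq_affine {l n : ℕ} (h1 : 3 ^ l ≤ n) (h2 : n ≤ 2 * 3 ^ l) :
    quantError cantorDist n = (1 / 9 + gain) / 25 ^ l - gain / 75 ^ l * n := by
  have hpos : 1 ≤ 3 ^ l := Nat.one_le_pow _ _ (by norm_num)
  refine le_antisymm (quantError_le_affine l n h1 h2)
    (le_quantError (hpos.trans h1) fun α hα hc => ?_)
  have h := excess_nonneg l α hα
  have hg : 0 ≤ gain / 75 ^ l := div_nonneg (by linarith [gain_ge]) (by positivity)
  have hc' : (α.card : ℝ) ≤ n := by exact_mod_cast hc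
  have := mul_le_mul_of_nonneg_left hc' hg
  unfold excess at h
  linarith

/-! ### A lower bound for the second quantization error -/

theorem le_integral_sqDist_pair_right {a b : ℝ} (hne : ({a, b} : Finset ℝ).Nonempty)
    (hab : a ≤ b) {T : ℝ → ℝ} (hT : Continuous T) {s d : ℝ} (hs : ∀ x, T x = s * x + d)
    (h : ∀ x ∈ Set.Icc (0 : ℝ) 1, a + b ≤ 2 * T x) :
    s ^ 2 / 9 + (s / 2 + d - b) ^ 2 ≤ ∫ x, sqDist {a, b} hne (T x) ∂cantorDist := by
  have e : ∫ x, (T x - b) ^ 2 ∂cantorDist = s ^ 2 / 9 + (s / 2 + d - b) ^ 2 := by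
    have : ∀ x, (T x - b) ^ 2 = s ^ 2 * x ^ 2 + (2 * s * (d - b)) * x + (d - b) ^ 2 :=
      fun x => by rw [hs]; ring
    simp only [this]
    rw [integral_quadratic, integral_sq_cantorDist]; ring
  rw [← e]
  refine integral_mono_Icc (by fun_prop) ((continuous_sqDist _ _).comp hT)
    fun x hx => Finset.le_inf' _ _ fun y hy => ?_
  rcases Finset.mem_insert.1 hy with rfl | hy
  · nlinarith [h x hx]
  · rw [Finset.mem_singleton.1 hy]

theorem le_integral_sqDist_pair_left {a b : ℝ} (hne : ({a, b} : Finset ℝ).Nonempty)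
    (hab : a ≤ b) {T : ℝ → ℝ} (hT : Continuous T) {s d : ℝ} (hs : ∀ x, T x = s * x + d)
    (h : ∀ x ∈ Set.Icc (0 : ℝ) 1, 2 * T x ≤ a + b) :
    s ^ 2 / 9 + (s / 2 + d - a) ^ 2 ≤ ∫ x, sqDist {a, b} hne (T x) ∂cantorDist := by
  have e : ∫ x, (T x - a) ^ 2 ∂cantorDist = s ^ 2 / 9 + (s / 2 + d - a) ^ 2 := by
    have : ∀ x, (T x - a) ^ 2 = s ^ 2 * x ^ 2 + (2 * s * (d - a)) * x + (d - a) ^ 2 :=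
      fun x => by rw [hs]; ring
    simp only [this]
    rw [integral_quadratic, integral_sq_cantorDist]; ring
  rw [← e]
  refine integral_mono_Icc (by fun_prop) ((continuous_sqDist _ _).comp hT)
    fun x hx => Finset.le_inf' _ _ fun y hy => ?_
  rcases Finset.mem_insert.1 hy with rfl | hy
  · exact le_rfl
  · rw [Finset.mem_singleton.1 hy]; nlinarith [h x hx]

theorem integral_sqDist_S (α : Finset ℝ) (hα : α.Nonempty) (j : Fin 3) :
    ∫ x, sqDist α hα (S j x) ∂cantorDist
      = (∑ k : Fin 3, ∫ x, sqDist α hα (S j (S k x)) ∂cantorDist) / 3 :=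
  integral_selfSimilar ((continuous_sqDist α hα).comp (continuous_S j))

/-- The position of the midpoint `(a + b)/2` decides which pieces, or second-level pieces of the
middle one, are served by `a` and which by `b`. A piece that might contain the midpoint is dropped.
-/
theorem distortion_pair_ge_of_add_le {a b : ℝ} (hne : ({a, b} : Finset ℝ).Nonempty)
    (hab : a ≤ b) (hs : a + b ≤ 1) : 1 / 50 ≤ distortion cantorDist {a, b} hne := by
  have c0 := continuous_S 0
  have c1 := continuous_S 1
  have c2 := continuous_S 2
  have I2 := le_integral_sqDist_pair_right hne hab c2 (s := 1 / 5) (d := 4 / 5)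
    (fun x => by rw [S_two]; ring) (fun x hx => by rw [S_two]; linarith [hx.1])
  rcases le_total (a + b) (2 / 5) with h4 | h4
  · have I1 := le_integral_sqDist_pair_right hne hab c1 (s := 1 / 5) (d := 2 / 5)
      (fun x => by rw [S_one]; ring) (fun x hx => by rw [S_one]; linarith [hx.1])
    refine le_trans ?_ (distortion_ge (integral_sqDist_nonneg 0) I1 I2)
    nlinarith [sq_nonneg (b - 7 / 10)]
  have I0 := le_integral_sqDist_pair_left hne hab c0 (s := 1 / 5) (d := 0)
    (fun x => by rw [S_zero]; ring) (fun x hx => by rw [S_zero]; linarith [hx.2])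
  have E1 := integral_sqDist_S {a, b} hne 1
  rw [Fin.sum_univ_three] at E1
  have I12 := le_integral_sqDist_pair_right hne hab (c1.comp c2) (s := 1 / 25) (d := 14 / 25)
    (fun x => by simp only [Function.comp]; rw [S_one, S_two]; ring)
    (fun x hx => by simp only [Function.comp]; rw [S_one, S_two]; linarith [hx.1])
  simp only [Function.comp] at I12
  have hD := distortion_eq_sum {a, b} hne
  rw [Fin.sum_univ_three] at hD
  rcases le_total (a + b) (22 / 25) with h8 | h8
  · have I11 := le_integral_sqDist_pair_right hne hab (c1.comp c1) (s := 1 / 25) (d := 12 / 25)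
      (fun x => by simp only [Function.comp]; rw [S_one, S_one]; ring)
      (fun x hx => by simp only [Function.comp]; rw [S_one, S_one]; linarith [hx.1])
    simp only [Function.comp] at I11
    -- `189/250` and `1/10` are the means of the retained pieces on either side.
    have n0 : 0 ≤ ∫ x, sqDist {a, b} hne (S 1 (S 0 x)) ∂cantorDist :=
      integral_nonneg fun x => sqDist_nonneg _ _ _
    nlinarith [sq_nonneg (b - 189 / 250), sq_nonneg (a - 1 / 10)]
  · have I10 := le_integral_sqDist_pair_left hne hab (c1.comp c0) (s := 1 / 25) (d := 2 / 5)
      (fun x => by simp only [Function.comp]; rw [S_one, S_zero]; ring)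
      (fun x hx => by simp only [Function.comp]; rw [S_one, S_zero]; linarith [hx.2])
    simp only [Function.comp] at I10
    have n1 : 0 ≤ ∫ x, sqDist {a, b} hne (S 1 (S 1 x)) ∂cantorDist :=
      integral_nonneg fun x => sqDist_nonneg _ _ _
    nlinarith [sq_nonneg (b - 41 / 50), sq_nonneg (a - 9 / 50)]

theorem distortion_pair_lower {a b : ℝ} (hne : ({a, b} : Finset ℝ).Nonempty) (hab : a ≤ b) :
    1 / 50 ≤ distortion cantorDist {a, b} hne := by
  rcases le_total (a + b) 1 with h | h
  · exact distortion_pair_ge_of_add_le hne hab h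
  · have e : reflect {a, b} = {1 - b, 1 - a} := by
      rw [reflect, Finset.image_insert, Finset.image_singleton, Finset.pair_comm]
    have key : ∀ (δ : Finset ℝ) (hδ : δ.Nonempty), δ = {1 - b, 1 - a} →
        1 / 50 ≤ distortion cantorDist δ hδ := by
      rintro δ hδ rfl
      exact distortion_pair_ge_of_add_le hδ (by linarith) (by linarith)
    rw [← distortion_reflect]
    exact key _ _ e

/-- Needed for `f_one_le`, whose polynomial minorant at `x = 2` is `28/5 · V₂`; the bound makes this
at least `14/125 > 1/9`. -/
theorem quantError_two_ge : 1 / 50 ≤ quantError cantorDist 2 := by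
  refine le_quantError (by norm_num) fun α hα hc => ?_
  rcases Nat.lt_or_ge 1 α.card with h2 | h2
  · obtain ⟨a, b, hab, rfl⟩ := Finset.card_eq_two.1 (le_antisymm hc h2)
    rcases le_total a b with h | h
    · exact distortion_pair_lower hα h
    · have key : ∀ (δ : Finset ℝ) (hδ : δ.Nonempty), δ = {b, a} →
          1 / 50 ≤ distortion cantorDist δ hδ := by
        rintro δ hδ rfl
        exact distortion_pair_lower hδ h
      exact key _ _ (Finset.pair_comm a b)
  · have := quantError_le α hα h2
    rw [quantError_one] at this
    linarith

/-! ### The function `f` -/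

theorem f_eq (x : ℝ) : f x = x ^ (2 / β) * ((1 / 9 + gain) - x * gain) := by
  unfold f gain
  rw [variance_cantorDist]
  ring

theorem f_one : f 1 = 1 / 9 := by
  rw [f_eq, Real.one_rpow]; ring

theorem three_rpow_two_div_β : (3 : ℝ) ^ (2 / β) = 25 := by
  have h3 : Real.log 3 ≠ 0 := (Real.log_pos (by norm_num)).ne'
  rw [Real.rpow_def_of_pos (by norm_num), β]
  rw [show Real.log 3 * (2 / (Real.log 3 / Real.log 5)) = Real.log 5 * (2 : ℕ) by
    push_cast; field_simp]
  rw [← Real.rpow_def_of_pos (by norm_num), Real.rpow_natCast]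
  norm_num

/-- Equivalent to `3^5 ≤ 5^4`. -/
theorem five_halves_le_two_div_β : 5 / 2 ≤ 2 / β := by
  have h3 : 0 < Real.log 3 := Real.log_pos (by norm_num)
  have h5 : 0 < Real.log 5 := Real.log_pos (by norm_num)
  have h : Real.log ((3 : ℝ) ^ 5) ≤ Real.log ((5 : ℝ) ^ 4) :=
    Real.log_le_log (by norm_num) (by norm_num)
  rw [Real.log_pow, Real.log_pow] at h
  push_cast at h
  rw [β, div_div_eq_mul_div, le_div_iff₀ h3]
  linarith

theorem rpow_mul_quantError_eq {l n : ℕ} (h1 : 3 ^ l ≤ n) (h2 : n ≤ 2 * 3 ^ l) :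
    (n : ℝ) ^ (2 / β) * quantError cantorDist n = f ((n : ℝ) / 3 ^ l) := by
  rw [quantError_eq_affine h1 h2, f_eq, Real.div_rpow (by positivity) (by positivity),
    ← Real.rpow_natCast 3 l, ← Real.rpow_mul (by norm_num), mul_comm (l : ℝ),
    Real.rpow_mul (by norm_num), three_rpow_two_div_β, Real.rpow_natCast, Real.rpow_natCast]
  have e : (75 : ℝ) ^ l = 25 ^ l * 3 ^ l := by rw [← mul_pow]; norm_num
  rw [e]
  field_simp

/-- `(3 + 2 x)/5` is the chord of `√x` over `[1, 9/4]`, so it minorizes `√x` by concavity. -/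
theorem f_lower {x : ℝ} (h1 : 1 ≤ x) (h2 : x ≤ 2) :
    x ^ 2 * ((3 + 2 * x) / 5) * (1 / 9 + gain - x * gain) ≤ f x := by
  rw [f_eq]
  have hL := gain_le
  have hL' := gain_ge
  have hx : 0 < x := by linarith
  refine mul_le_mul_of_nonneg_right ?_ (by nlinarith)
  calc x ^ 2 * ((3 + 2 * x) / 5) ≤ x ^ 2 * √x := by
        gcongr
        apply Real.le_sqrt_of_sq_le
        nlinarith
    _ = x ^ (5 / 2 : ℝ) := by
        rw [Real.sqrt_eq_rpow, ← Real.rpow_natCast, ← Real.rpow_add hx]; norm_num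
    _ ≤ x ^ (2 / β) := Real.rpow_le_rpow_of_exponent_le h1 five_halves_le_two_div_β

theorem f_one_le {x : ℝ} (h1 : 1 ≤ x) (h2 : x ≤ 2) : f 1 ≤ f x := by
  rw [f_one]
  refine le_trans ?_ (f_lower h1 h2)
  have hq : gain ≤ 41 / 450 := by
    have := quantError_two_ge
    unfold gain; linarith
  have hmono : x ^ 2 * ((3 + 2 * x) / 5) * (1 / 9 + 41 / 450 - x * (41 / 450))
      ≤ x ^ 2 * ((3 + 2 * x) / 5) * (1 / 9 + gain - x * gain) := by
    have : 0 ≤ x ^ 2 * ((3 + 2 * x) / 5) := by positivity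
    exact mul_le_mul_of_nonneg_left (by nlinarith) this
  refine le_trans ?_ hmono
  obtain ⟨y, rfl⟩ : ∃ y, x = 1 + y := ⟨x - 1, by ring⟩
  have hy0 : 0 ≤ y := by linarith
  have hy1 : 0 ≤ 1 - y := by linarith
  nlinarith [mul_nonneg hy0 hy1, mul_nonneg (mul_nonneg hy0 hy0) hy1,
    mul_nonneg (mul_nonneg (mul_nonneg hy0 hy0) hy0) hy1, mul_nonneg hy0 hy0]

theorem f_one_lt : f 1 < f (3 / 2) := by
  rw [f_one]
  refine lt_of_lt_of_le ?_ (f_lower (by norm_num) (by norm_num))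
  have := gain_le
  norm_num
  linarith

theorem continuousAt_f {x : ℝ} (hx : x ≠ 0) : ContinuousAt f x := by
  have : f = fun x => x ^ (2 / β) * ((1 / 9 + gain) - x * gain) := funext f_eq
  rw [this]
  exact (Real.continuousAt_rpow_const x _ (Or.inl hx)).mul (by fun_prop)

theorem continuousOn_f : ContinuousOn f (Set.Icc 1 2) := fun x hx =>
  (continuousAt_f (by linarith [hx.1] : x ≠ 0)).continuousWithinAt

/-! ### Accumulation points -/

/-- The integers `n` with `3 ^ l ≤ n ≤ 2 * 3 ^ l` for some `l`. -/
def blocks : Set ℕ := {n : ℕ | ∃ l : ℕ, 3 ^ l ≤ n ∧ n ≤ 2 * 3 ^ l}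

theorem div_mem_Icc {l n : ℕ} (h1 : 3 ^ l ≤ n) (h2 : n ≤ 2 * 3 ^ l) :
    (n : ℝ) / 3 ^ l ∈ Set.Icc (1 : ℝ) 2 := by
  have h1' : (3 : ℝ) ^ l ≤ n := by exact_mod_cast h1
  have h2' : (n : ℝ) ≤ 2 * 3 ^ l := by exact_mod_cast h2
  exact ⟨by rwa [one_le_div (by positivity)], by rwa [div_le_iff₀ (by positivity)]⟩

theorem image_f_Icc {M : ℝ} (hM : IsGreatest (f '' Set.Icc 1 2) M) :
    f '' Set.Icc 1 2 = Set.Icc (f 1) M := by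
  refine Set.Subset.antisymm ?_ ?_
  · rintro _ ⟨x, hx, rfl⟩
    exact ⟨f_one_le hx.1 hx.2, hM.2 ⟨x, hx, rfl⟩⟩
  · obtain ⟨x₀, hx₀, rfl⟩ := hM.1
    refine (intermediate_value_Icc hx₀.1
      (continuousOn_f.mono (Set.Icc_subset_Icc_right hx₀.2))).trans (Set.image_mono ?_)
    exact Set.Icc_subset_Icc_right hx₀.2

theorem mapClusterPt_f {x : ℝ} (hx : x ∈ Set.Icc (1 : ℝ) 2) :
    MapClusterPt (f x) (Filter.atTop ⊓ Filter.principal blocks)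
      (fun n : ℕ => (n : ℝ) ^ (2 / β) * quantError cantorDist n) := by
  have hx0 : 0 ≤ x := by linarith [hx.1]
  set φ : ℕ → ℕ := fun l => ⌊x * 3 ^ l⌋₊ with hφ
  have hlow : ∀ l, 3 ^ l ≤ φ l := fun l => by
    refine Nat.le_floor ?_
    push_cast
    nlinarith [hx.1, show (0 : ℝ) < 3 ^ l by positivity]
  have hupp : ∀ l, φ l ≤ 2 * 3 ^ l := fun l => by
    have h : (φ l : ℝ) ≤ x * 3 ^ l := Nat.floor_le (by positivity)
    have : (φ l : ℝ) ≤ 2 * 3 ^ l := h.trans (by gcongr; exact hx.2)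
    exact_mod_cast this
  have htop : Filter.Tendsto φ Filter.atTop (Filter.atTop ⊓ Filter.principal blocks) := by
    refine Filter.tendsto_inf.2 ⟨?_, Filter.tendsto_principal.2
      (Filter.Eventually.of_forall fun l => ⟨l, hlow l, hupp l⟩)⟩
    exact Filter.tendsto_atTop_mono hlow (tendsto_pow_atTop_atTop_of_one_lt (by norm_num))
  have hdiv : Filter.Tendsto (fun l : ℕ => (φ l : ℝ) / 3 ^ l) Filter.atTop (nhds x) :=
    (tendsto_nat_floor_mul_div_atTop hx0).comp
      (tendsto_pow_atTop_atTop_of_one_lt (by norm_num : (1 : ℝ) < 3))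
  have hf : Filter.Tendsto (fun l : ℕ => f ((φ l : ℝ) / 3 ^ l)) Filter.atTop (nhds (f x)) :=
    (continuousAt_f (by linarith [hx.1])).tendsto.comp hdiv
  refine MapClusterPt.of_comp htop (Filter.Tendsto.mapClusterPt ?_)
  refine hf.congr fun l => ?_
  exact (rpow_mul_quantError_eq (hlow l) (hupp l)).symm

/-- Cluster points along `atTop ⊓ 𝓟 blocks` are the limits of subsequences of the enumerated
sequence. The values along `blocks` lie in the closed interval `f '' [1, 2]`, so no others arise. -/
theorem setOf_mapClusterPt_eq {M : ℝ} (hM : IsGreatest (f '' Set.Icc 1 2) M) :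
    {y : ℝ | MapClusterPt y (Filter.atTop ⊓ Filter.principal blocks)
      (fun n : ℕ => (n : ℝ) ^ (2 / β) * quantError cantorDist n)} = Set.Icc (f 1) M := by
  refine Set.Subset.antisymm (fun y hy => ?_) fun y hy => ?_
  · refine isClosed_Icc.mem_of_mapClusterPt hy ?_
    refine Filter.mem_inf_of_right (Filter.mem_principal.2 ?_)
    rintro n ⟨l, h1, h2⟩
    rw [← image_f_Icc hM]
    exact ⟨_, div_mem_Icc h1 h2, (rpow_mul_quantError_eq h1 h2).symm⟩
  · rw [← image_f_Icc hM] at hy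
    obtain ⟨x, hx, rfl⟩ := hy
    exact mapClusterPt_f hx

theorem not_hasQuantCoeff (L : ℝ) : ¬ HasQuantCoeff cantorDist β L := by
  intro hL
  have h : ∀ x ∈ Set.Icc (1 : ℝ) 2, f x = L := fun x hx => by
    have hc := (mapClusterPt_f hx).mono inf_le_left
    exact eq_of_nhds_neBot (Filter.NeBot.mono hc (inf_le_inf_left _ hL))
  have h1 := h 1 ⟨le_rfl, by norm_num⟩
  have h2 := h (3 / 2) ⟨by norm_num, by norm_num⟩
  have := f_one_lt
  linarith

end TriadicCantor

end

theorem mainTheorem2 :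
    (∀ l n : ℕ, 3 ^ l ≤ n → n ≤ 2 * 3 ^ l →
      (n : ℝ) ^ (2 / TriadicCantor.β) * TriadicCantor.quantError TriadicCantor.cantorDist n
        = TriadicCantor.f ((n : ℝ) / 3 ^ l)) ∧
    (∃ M : ℝ, IsGreatest (TriadicCantor.f '' Set.Icc 1 2) M ∧ TriadicCantor.f 1 < M ∧
      {y : ℝ | MapClusterPt y
          (Filter.atTop ⊓ Filter.principal {n : ℕ | ∃ l : ℕ, 3 ^ l ≤ n ∧ n ≤ 2 * 3 ^ l})
          (fun n : ℕ => (n : ℝ) ^ (2 / TriadicCantor.β)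
            * TriadicCantor.quantError TriadicCantor.cantorDist n)}
        = Set.Icc (TriadicCantor.f 1) M) ∧
    ¬ ∃ L : ℝ, TriadicCantor.HasQuantCoeff TriadicCantor.cantorDist TriadicCantor.β L := by
  refine ⟨fun l n h1 h2 => TriadicCantor.rpow_mul_quantError_eq h1 h2, ?_,
    fun ⟨L, hL⟩ => TriadicCantor.not_hasQuantCoeff L hL⟩
  obtain ⟨M, hM⟩ := (isCompact_Icc.image_of_continuousOn
    TriadicCantor.continuousOn_f).exists_isGreatest ((Set.nonempty_Icc.2 (by norm_num)).image _)
  exact ⟨M, hM, TriadicCantor.f_one_lt.trans_le (hM.2 ⟨3 / 2, by norm_num, rfl⟩),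
    TriadicCantor.setOf_mapClusterPt_eq hM⟩
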